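/- A Schur partition is a partition of a non-negative integer in which any two consecutive parts differ by at least $3$ and no two consecutive multiples of $3$ (that is, $3k$ and $3k+3$) both occur as parts. For a partition $\pi$ let $m(\pi)$ be the number of parts plus the number of even parts of $\pi$. For integers $N,m,n$ let $\mathcal{D}_N(m,n)$ be the set of Schur partitions $\pi$ of $n$ with $m(\pi)=m$ and all parts $\le N$ (it is empty if $m<0$ or $n<0$), let $D_N(m,n)=|\mathcal{D}_N(m,n)|$, and let $$d_N(x)=\sum_{m,n\ge 0}D_N(m,n)\,x^mq^n\in\mathbb{Z}[q][x]$$ be the Alladi–Schur polynomial; in particular $d_{-1}(x)=1$, since only the empty partition has all parts $\le -1$. Theorem. Let $N\ge 1$ be an integer. There is a map $\phi_{2N}$ on partitions that, for all integers $m,n$, restricts to a bijection $$\phi_{2N}:\mathcal{D}_{2N}(m,n)\to\mathcal{D}_{2N-3}(m,n-2m)\cup\mathcal{D}_{2N-3}(m-1,n-2m+1)\cup\mathcal{D}_{2N-3}(m-2,n-2m+2).$$ Moreover, for all integers $m,n$, $$D_{2N}(m,n)=D_{2N-3}(m,n-2m)+D_{2N-3}(m-1,n-2m+1)+D_{2N-3}(m-2,n-2m+2),$$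 and $$d_{2N}(x)=(1+xq+x^2q^2)\,d_{2N-3}(xq^2).$$ -/

import Mathlib

open Polynomial

/-- Integer partitions of arbitrary size `π.1`, with multiset of (positive) parts `π.2.parts`. -/
abbrev IntPartition : Type := Σ k : ℕ, k.Partition

namespace IntPartition

/-- The multiset of parts. -/
def parts (π : IntPartition) : Multiset ℕ := π.2.parts

/-- The sum `σ(π)` of the parts. -/
def size (π : IntPartition) : ℕ := π.parts.sum

/-- `m(π)`: the number of parts plus the number of even parts. -/
def weight (π : IntPartition) : ℕ :=
  Multiset.card π.parts + Multiset.card (π.parts.filter Even)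

/-- Schur partitions: no part is repeated, any two different parts differ by at least `3`,
and no two consecutive multiples of `3` are both parts. -/
structure IsSchur (π : IntPartition) : Prop where
  nodup : π.parts.Nodup
  gap : ∀ a ∈ π.parts, ∀ b ∈ π.parts, a < b → a + 3 ≤ b
  mult : ∀ a ∈ π.parts, 3 ∣ a → a + 3 ∉ π.parts

end IntPartition

/-- `𝒟_N(m,n)`: the Schur partitions `π` of `n` with `m(π) = m` and all parts at most `N`.
The indices are integers; the set is empty if `m` or `n` is negative. -/
def schurSet (N m n : ℤ) : Set IntPartition :=
  {π | π.IsSchur ∧ (π.size : ℤ) = n ∧ (π.weight : ℤ) = m ∧ ∀ a ∈ π.parts, (a : ℤ) ≤ N}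

/-- `D_N(m,n) = |𝒟_N(m,n)|`. -/
noncomputable def schurCount (N m n : ℤ) : ℕ := (schurSet N m n).ncard

/-- The Alladi–Schur polynomial `d_N(x) = ∑_{m,n ≥ 0} D_N(m,n) x^m q^n` in `ℤ[q][x]`:
the outer variable is `x`, the inner one is `q`. -/
noncomputable def alladiSchur (N : ℤ) : ℤ[X][X] :=
  ∑ᶠ p : ℕ × ℕ, C (C (schurCount N p.1 p.2 : ℤ) * X ^ p.2) * X ^ p.1

/-- Only finitely many Schur partitions have all parts at most `N`. -/
theorem finite_schur_le (N : ℤ) :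
    {π : IntPartition | π.IsSchur ∧ ∀ a ∈ π.parts, (a : ℤ) ≤ N}.Finite := by
  have hinj : Function.Injective IntPartition.parts := by
    rintro ⟨k, p⟩ ⟨l, r⟩ h
    change p.parts = r.parts at h
    have hkl : k = l := by rw [← p.parts_sum, ← r.parts_sum, h]
    subst hkl
    have : p = r := Nat.Partition.ext h
    rw [this]
  refine Set.Finite.of_finite_image (f := IntPartition.parts) ?_ hinj.injOn
  refine (Set.finite_Iic (Multiset.range (N.toNat + 1))).subset ?_
  rintro _ ⟨π, ⟨hS, hb⟩, rfl⟩
  refine (Multiset.le_iff_subset hS.nodup).2 fun a ha => ?_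
  have := hb a ha
  rw [Multiset.mem_range]
  omega

theorem finite_schurSet (N m n : ℤ) : (schurSet N m n).Finite :=
  (finite_schur_le N).subset fun _ h => ⟨h.1, h.2.2.2⟩

/-- The sum defining `alladiSchur` has finite support. -/
theorem alladiSchur_finite_support (N : ℤ) :
    (Function.support fun p : ℕ × ℕ =>
      (C (C (schurCount N p.1 p.2 : ℤ) * X ^ p.2) * X ^ p.1 : ℤ[X][X])).Finite := by
  refine ((finite_schur_le N).image fun π => (π.weight, π.size)).subset ?_
  intro p hp
  have h0 : schurCount N p.1 p.2 ≠ 0 := by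
    intro h
    apply hp
    simp [h]
  obtain ⟨π, hπ⟩ := Set.nonempty_of_ncard_ne_zero h0
  refine ⟨π, ⟨hπ.1, hπ.2.2.2⟩, ?_⟩
  have h1 := hπ.2.1
  have h2 := hπ.2.2.1
  exact Prod.ext (by exact_mod_cast h2) (by exact_mod_cast h1)

/-- The coefficient of `x^m q^n` in `d_N(x)` is `D_N(m,n)`. -/
theorem alladiSchur_coeff (N : ℤ) (m n : ℕ) :
    ((alladiSchur N).coeff m).coeff n = (schurCount N m n : ℤ) := by
  have hf := alladiSchur_finite_support N
  rw [alladiSchur, finsum_eq_sum _ hf]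
  simp only [finsetSum_coeff, coeff_C_mul, coeff_X_pow, mul_ite, mul_one, mul_zero]
  rw [Finset.sum_eq_single (m, n)]
  · simp
  · rintro ⟨a, b⟩ - hab
    by_cases ha : m = a
    · have hb : n ≠ b := fun hb => hab (by rw [ha, hb])
      simp [ha, hb, coeff_X_pow]
    · simp [ha]
  · intro h
    rw [Set.Finite.mem_toFinset, Function.mem_support, not_not] at h
    have h' := congrArg (fun P : ℤ[X][X] => (P.coeff m).coeff n) h
    simpa only [coeff_C_mul, coeff_X_pow, coeff_zero, if_true, mul_one] using h'

/-! Removing the largest part `a` of a Schur partition leaves parts at most `a - 3`, or `a - 4` if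
`3 ∣ a`. Hence `d_a(x) = d_{a-1}(x) + q^a x^e d_M(x)`, with `M` that bound and `e` equal to 1 or 2
as `a` is odd or even (`alladiSchur_rec`). The sequence `g_N = d_N(xq²)` obeys the same recurrence
with `x` replaced by `xq²`. The recurrence depends on `a` mod 6, so `d_{2N} = (1 + xq + x²q²)
g_{2N-3}` follows by induction, one period of three even indices at a time (`factor_period`).

Comparing coefficients gives the identity for `D_{2N}(m,n)`. The bijection is then obtained by
counting, not constructed: the sets are finite, and the three targets are disjoint because their
weights differ. -/

namespace IntPartition

theorem parts_injective : Function.Injective parts := by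
  rintro ⟨k, p⟩ ⟨l, r⟩ h
  change p.parts = r.parts at h
  have hkl : k = l := by rw [← p.parts_sum, ← r.parts_sum, h]
  subst hkl
  rw [Nat.Partition.ext h]

theorem pos_of_mem {π : IntPartition} {a : ℕ} (h : a ∈ π.parts) : 0 < a :=
  π.2.parts_pos h

/-- The partition with a given multiset of positive parts. -/
def ofParts (s : Multiset ℕ) (hs : ∀ a ∈ s, 0 < a) : IntPartition :=
  ⟨s.sum, ⟨s, fun h => hs _ h, rfl⟩⟩

@[simp] theorem parts_ofParts (s : Multiset ℕ) (hs : ∀ a ∈ s, 0 < a) :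
    (ofParts s hs).parts = s := rfl

/-- Adjoin one positive part. -/
def addPart (a : ℕ) (ha : 0 < a) (π : IntPartition) : IntPartition :=
  ofParts (a ::ₘ π.parts) fun b hb => by
    rcases Multiset.mem_cons.1 hb with rfl | hb
    exacts [ha, pos_of_mem hb]

@[simp] theorem parts_addPart (a : ℕ) (ha : 0 < a) (π : IntPartition) :
    (addPart a ha π).parts = a ::ₘ π.parts := rfl

theorem addPart_injective (a : ℕ) (ha : 0 < a) : Function.Injective (addPart a ha) := by
  intro π ρ h
  apply parts_injective
  simpa using congrArg parts h

theorem size_addPart (a : ℕ) (ha : 0 < a) (π : IntPartition) :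
    (addPart a ha π).size = a + π.size := by
  simp [size]

theorem weight_addPart (a : ℕ) (ha : 0 < a) (π : IntPartition) :
    (addPart a ha π).weight = (if Even a then 2 else 1) + π.weight := by
  by_cases h : Even a
  · simp [weight, h]; omega
  · simp [weight, h]; omega

/-- The Schur partitions with all parts at most `N`. -/
noncomputable def schurLE (N : ℤ) : Finset IntPartition := (finite_schur_le N).toFinset

theorem mem_schurLE {N : ℤ} {π : IntPartition} :
    π ∈ schurLE N ↔ π.IsSchur ∧ ∀ a ∈ π.parts, (a : ℤ) ≤ N := by
  simp [schurLE]

/-- The monomial recording weight and size. -/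
noncomputable def monomial (π : IntPartition) : ℤ[X][X] := C (X ^ π.size) * X ^ π.weight

theorem monomial_addPart (a : ℕ) (ha : 0 < a) (π : IntPartition) :
    (addPart a ha π).monomial =
      C (X ^ a) * X ^ (if Even a then 2 else 1) * π.monomial := by
  simp only [monomial, size_addPart, weight_addPart, pow_add, C_mul]
  ring

-- Either `a` is not a part, or it is the largest and can be erased. The gap condition then bounds
-- the rest by `a - 3`; for `3 ∣ a`, the value `a - 3` is also forbidden. Conversely, the bound `M`
-- is exactly what makes adjoining `a` safe.
open Classical in
theorem schurLE_eq (a : ℕ) (ha : 0 < a) (M : ℤ)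
    (hM : M = if 3 ∣ a then (a : ℤ) - 4 else (a : ℤ) - 3) :
    schurLE a = schurLE (a - 1) ∪ (schurLE M).image (addPart a ha) := by
  have hM3 : M ≤ a - 3 := by split_ifs at hM <;> omega
  ext π
  simp only [Finset.mem_union, Finset.mem_image, mem_schurLE]
  constructor
  · rintro ⟨hS, hb⟩
    by_cases hm : a ∈ π.parts
    · right
      have hc := Multiset.cons_erase hm
      have hnd := hS.nodup
      refine ⟨ofParts (π.parts.erase a) fun b hb => pos_of_mem (Multiset.mem_of_mem_erase hb),
        ⟨⟨hnd.erase a, ?_, ?_⟩, ?_⟩, parts_injective (by simpa using hc)⟩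
      · intro b hb c hc
        exact hS.gap b (Multiset.mem_of_mem_erase hb) c (Multiset.mem_of_mem_erase hc)
      · intro b hb h3 hc
        exact hS.mult b (Multiset.mem_of_mem_erase hb) h3 (Multiset.mem_of_mem_erase hc)
      · intro b hb'
        obtain ⟨hne, hbm⟩ := hnd.mem_erase_iff.1 hb'
        have h1 := hb b hbm
        have h2 := hS.gap b hbm a hm (by omega)
        split_ifs at hM with h3
        · have : b + 3 ≠ a := fun h => hS.mult b hbm (by omega) (h ▸ hm)
          omega
        · omega
    · left
      refine ⟨hS, fun b hbm => ?_⟩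
      have h1 := hb b hbm
      have : b ≠ a := fun h => hm (h ▸ hbm)
      omega
  · rintro (⟨hS, hb⟩ | ⟨ρ, ⟨hS, hb⟩, rfl⟩)
    · exact ⟨hS, fun b hbm => by have := hb b hbm; omega⟩
    · refine ⟨⟨?_, ?_, ?_⟩, ?_⟩
      · exact Multiset.nodup_cons.2 ⟨fun h => by have := hb a h; omega, hS.nodup⟩
      · intro b hb' c hc' hbc
        rcases Multiset.mem_cons.1 hb' with rfl | hbρ <;>
          rcases Multiset.mem_cons.1 hc' with rfl | hcρ
        · omega
        · have := hb c hcρ; omega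
        · have := hb b hbρ; omega
        · exact hS.gap b hbρ c hcρ hbc
      · intro b hb' h3 hc'
        rcases Multiset.mem_cons.1 hb' with rfl | hb' <;>
          rcases Multiset.mem_cons.1 hc' with hc' | hc'
        · omega
        · have := hb _ hc'; omega
        · have := hb b hb'
          rw [if_pos (by omega)] at hM
          omega
        · exact hS.mult b hb' h3 hc'
      · intro b hb'
        rcases Multiset.mem_cons.1 hb' with rfl | hb'
        · exact le_rfl
        · have := hb b hb'; omega

end IntPartition

/-! ### Generating functions and the recurrence -/

open IntPartition

theorem alladiSchur_eq_sum (N : ℤ) : alladiSchur N = ∑ π ∈ schurLE N, π.monomial := by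
  classical
  ext m n
  rw [alladiSchur_coeff]
  have hs : schurSet N m n =
      ((schurLE N).filter fun π => m = π.weight ∧ n = π.size : Finset IntPartition) := by
    ext π
    simp only [schurSet, Set.mem_ofPred_eq, Finset.coe_filter, mem_schurLE, Nat.cast_inj,
      eq_comm (a := m), eq_comm (a := n)]
    tauto
  rw [schurCount, hs, Set.ncard_coe_finset, Finset.card_filter, Nat.cast_sum]
  simp only [finsetSum_coeff]
  refine Finset.sum_congr rfl fun π _ => ?_
  simp only [IntPartition.monomial, coeff_C_mul, coeff_X_pow]
  by_cases h1 : m = π.weight <;> by_cases h2 : n = π.size <;> simp [h1, h2, coeff_X_pow]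

theorem alladiSchur_of_lt_one {N : ℤ} (hN : N < 1) : alladiSchur N = 1 := by
  have h : schurLE N = {ofParts 0 (by simp)} := by
    ext π
    simp only [mem_schurLE, Finset.mem_singleton]
    constructor
    · rintro ⟨-, hb⟩
      refine parts_injective (Multiset.eq_zero_of_forall_notMem fun a ha => ?_)
      have h1 := hb a ha
      have h2 := pos_of_mem ha
      omega
    · rintro rfl
      exact ⟨⟨by simp, by simp, by simp⟩, by simp⟩
  rw [alladiSchur_eq_sum, h, Finset.sum_singleton]
  simp [IntPartition.monomial, size, weight]

/-- Splitting off the largest part. -/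
theorem alladiSchur_rec (a : ℕ) (ha : 0 < a) (M : ℤ)
    (hM : M = if 3 ∣ a then (a : ℤ) - 4 else (a : ℤ) - 3) :
    alladiSchur a =
      alladiSchur (a - 1) + C (X ^ a) * X ^ (if Even a then 2 else 1) * alladiSchur M := by
  classical
  simp only [alladiSchur_eq_sum]
  rw [schurLE_eq a ha M hM, Finset.sum_union,
    Finset.sum_image ((addPart_injective a ha).injOn), Finset.mul_sum]
  · simp only [monomial_addPart]
  · rw [Finset.disjoint_left]
    intro π h1 h2
    obtain ⟨ρ, -, rfl⟩ := Finset.mem_image.1 h2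
    have := (mem_schurLE.1 h1).2 a (by simp)
    omega

/-- The recurrence satisfied by the Alladi–Schur polynomials, for elements `x`, `q` of a
commutative ring. -/
structure IsSchurSeq {R : Type*} [CommRing R] (x q : R) (d : ℤ → R) : Prop where
  init : ∀ N < 1, d N = 1
  step : ∀ (a : ℕ) (b M : ℤ), 0 < a → b = a - 1 →
    (M = if 3 ∣ a then (a : ℤ) - 4 else (a : ℤ) - 3) →
    d a = d b + q ^ a * x ^ (if Even a then 2 else 1) * d M

theorem isSchurSeq_alladiSchur : IsSchurSeq (X : ℤ[X][X]) (C X) alladiSchur where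
  init _ h := alladiSchur_of_lt_one h
  step a b M ha hb hM := by
    rw [hb, alladiSchur_rec a ha M hM, C_pow]

/-- Applied to the substitution `x ↦ xq²`, this gives the recurrence for `d_N(xq²)`. -/
theorem IsSchurSeq.map {R S : Type*} [CommRing R] [CommRing S] {x q : R} {d : ℤ → R}
    (h : IsSchurSeq x q d) (f : R →+* S) : IsSchurSeq (f x) (f q) fun N => f (d N) where
  init N hN := by simp [h.init N hN]
  step a b M ha hb hM := by simp only [h.step a b M ha hb hM, map_add, map_mul, map_pow]

/-! ### Factorization from the recurrence, by residues mod 6 -/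

section Recurrence

variable {R : Type*} [CommRing R] {x q : R} {d g : ℤ → R}

theorem IsSchurSeq.step_odd (h : IsSchurSeq x q d) (j r : ℕ) (N b M : ℤ)
    (hN : N = 6 * j + r) (hr : r % 6 = 1 ∨ r % 6 = 5) (hb : b = N - 1) (hM : M = N - 3) :
    d N = d b + (q ^ 6) ^ j * q ^ r * x * d M := by
  have := h.step (6 * j + r) b M (by omega) (by omega) (by
    rw [if_neg (by omega)]; omega)
  rw [if_neg (by rw [Nat.even_iff]; omega), pow_add, pow_mul, pow_one] at this
  rw [← this, hN]; push_cast; rfl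

theorem IsSchurSeq.step_even (h : IsSchurSeq x q d) (j r : ℕ) (N b M : ℤ)
    (hN : N = 6 * j + r) (hr : r % 6 = 2 ∨ r % 6 = 4) (hb : b = N - 1) (hM : M = N - 3) :
    d N = d b + (q ^ 6) ^ j * q ^ r * x ^ 2 * d M := by
  have := h.step (6 * j + r) b M (by omega) (by omega) (by
    rw [if_neg (by omega)]; omega)
  rw [if_pos (by rw [Nat.even_iff]; omega), pow_add, pow_mul] at this
  rw [← this, hN]; push_cast; rfl

theorem IsSchurSeq.step_three (h : IsSchurSeq x q d) (j r : ℕ) (N b M : ℤ)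
    (hN : N = 6 * j + r) (hr : r % 6 = 3) (hb : b = N - 1) (hM : M = N - 4) :
    d N = d b + (q ^ 6) ^ j * q ^ r * x * d M := by
  have := h.step (6 * j + r) b M (by omega) (by omega) (by
    rw [if_pos (by omega)]; omega)
  rw [if_neg (by rw [Nat.even_iff]; omega), pow_add, pow_mul, pow_one] at this
  rw [← this, hN]; push_cast; rfl

theorem IsSchurSeq.step_six (h : IsSchurSeq x q d) (j r : ℕ) (N b M : ℤ)
    (hN : N = 6 * j + r) (hr : r % 6 = 0) (hr0 : 0 < r) (hb : b = N - 1) (hM : M = N - 4) :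
    d N = d b + (q ^ 6) ^ j * q ^ r * x ^ 2 * d M := by
  have := h.step (6 * j + r) b M (by omega) (by omega) (by
    rw [if_pos (by omega)]; omega)
  rw [if_pos (by rw [Nat.even_iff]; omega), pow_add, pow_mul] at this
  rw [← this, hN]; push_cast; rfl

/-- Three consecutive even-indexed instances of the factorization, one period at a time. -/
theorem IsSchurSeq.factor_period (hd : IsSchurSeq x q d) (hg : IsSchurSeq (x * q ^ 2) q g)
    (j : ℕ) :
    d (6 * j + 2) = (1 + x * q + x ^ 2 * q ^ 2) * g (6 * j - 1) ∧
    d (6 * j + 4) = (1 + x * q + x ^ 2 * q ^ 2) * g (6 * j + 1) ∧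
    d (6 * j + 6) = (1 + x * q + x ^ 2 * q ^ 2) * g (6 * j + 3) := by
  -- Both sides satisfy one relation: `d(6j+6) = d(6j+4) + q^(6j+5) x(1+xq) d(6j+2)`, and likewise
  -- for `g` with indices lowered by 3.
  have last (j : ℕ)
      (h2 : d (6 * j + 2) = (1 + x * q + x ^ 2 * q ^ 2) * g (6 * j - 1))
      (h4 : d (6 * j + 4) = (1 + x * q + x ^ 2 * q ^ 2) * g (6 * j + 1)) :
      d (6 * j + 6) = (1 + x * q + x ^ 2 * q ^ 2) * g (6 * j + 3) := by
    rw [hd.step_six j 6 _ (6 * j + 5) (6 * j + 2), hd.step_odd j 5 _ (6 * j + 4) (6 * j + 2),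
      hg.step_three j 3 _ (6 * j + 2) (6 * j - 1), hg.step_even j 2 _ (6 * j + 1) (6 * j - 1),
      h2, h4]
    · ring
    all_goals omega
  induction j with
  | zero =>
    have d1 := hd.step_odd 0 1 1 0 (-2) (by norm_num) (by norm_num) (by norm_num) (by norm_num)
    have d2 := hd.step_even 0 2 2 1 (-1) (by norm_num) (by norm_num) (by norm_num) (by norm_num)
    have d3 := hd.step_three 0 3 3 2 (-1) (by norm_num) (by norm_num) (by norm_num) (by norm_num)
    have d4 := hd.step_even 0 4 4 3 1 (by norm_num) (by norm_num) (by norm_num) (by norm_num)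
    have g1 := hg.step_odd 0 1 1 0 (-2) (by norm_num) (by norm_num) (by norm_num) (by norm_num)
    rw [hd.init 0 (by norm_num), hd.init (-2) (by norm_num)] at d1
    rw [hg.init 0 (by norm_num), hg.init (-2) (by norm_num)] at g1
    rw [hd.init (-1) (by norm_num)] at d2 d3
    have h2 : d 2 = (1 + x * q + x ^ 2 * q ^ 2) * g (-1) := by
      rw [hg.init (-1) (by norm_num), d2, d1]; ring
    have h4 : d 4 = (1 + x * q + x ^ 2 * q ^ 2) * g 1 := by
      rw [d4, d3, d2, d1, g1]; ring
    have h6 := last 0 (by simpa using h2) (by simpa using h4)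
    exact ⟨by simpa using h2, by simpa using h4, h6⟩
  | succ j ih =>
    obtain ⟨h2, h4, h6⟩ := ih
    have e (r : ℤ) : 6 * ((j + 1 : ℕ) : ℤ) + r = 6 * j + (r + 6) := by push_cast; ring
    have d5 := hd.step_odd j 5 (6 * j + 5) (6 * j + 4) (6 * j + 2)
      (by norm_num) (by norm_num) (by ring) (by ring)
    have d7 := hd.step_odd j 7 (6 * j + 7) (6 * j + 6) (6 * j + 4)
      (by norm_num) (by norm_num) (by ring) (by ring)
    have d8 := hd.step_even j 8 (6 * j + 8) (6 * j + 7) (6 * j + 5)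
      (by norm_num) (by norm_num) (by ring) (by ring)
    have d9 := hd.step_three j 9 (6 * j + 9) (6 * j + 8) (6 * j + 5)
      (by norm_num) (by norm_num) (by ring) (by ring)
    have d10 := hd.step_even j 10 (6 * j + 10) (6 * j + 9) (6 * j + 7)
      (by norm_num) (by norm_num) (by ring) (by ring)
    have g2 := hg.step_even j 2 (6 * j + 2) (6 * j + 1) (6 * j - 1)
      (by norm_num) (by norm_num) (by ring) (by ring)
    have g3 := hg.step_three j 3 (6 * j + 3) (6 * j + 2) (6 * j - 1)
      (by norm_num) (by norm_num) (by ring) (by ring)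
    have g4 := hg.step_even j 4 (6 * j + 4) (6 * j + 3) (6 * j + 1)
      (by norm_num) (by norm_num) (by ring) (by ring)
    have g5 := hg.step_odd j 5 (6 * j + 5) (6 * j + 4) (6 * j + 2)
      (by norm_num) (by norm_num) (by ring) (by ring)
    have g6 := hg.step_six j 6 (6 * j + 6) (6 * j + 5) (6 * j + 2)
      (by norm_num) (by norm_num) (by norm_num) (by ring) (by ring)
    have g7 := hg.step_odd j 7 (6 * j + 7) (6 * j + 6) (6 * j + 4)
      (by norm_num) (by norm_num) (by ring) (by ring)
    -- Again a common relation: `d(6j+8) = d(6j+6) + q^(6j+7) x(1+xq) d(6j+4) + q^(12j+13) x³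
    -- d(6j+2)`.
    have h8 : d (6 * j + 8) = (1 + x * q + x ^ 2 * q ^ 2) * g (6 * j + 5) := by
      rw [d8, d7, d5, h6, h4, h2, g5, g4, g3, g2]; ring
    -- Here the two expansions differ term by term; they agree once `g(6j+3)` is itself reduced to
    -- `g(6j+1)` and `g(6j-1)`.
    have h10 : d (6 * j + 10) = (1 + x * q + x ^ 2 * q ^ 2) * g (6 * j + 7) := by
      rw [d10, d9, h8, d7, d5, h6, h4, h2, g7, g6, g5, g4, g3, g2]; ring
    have k2 : d (6 * (j + 1 : ℕ) + 2) =
        (1 + x * q + x ^ 2 * q ^ 2) * g (6 * (j + 1 : ℕ) - 1) := by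
      rw [sub_eq_add_neg, e, e]; exact h8
    have k4 : d (6 * (j + 1 : ℕ) + 4) =
        (1 + x * q + x ^ 2 * q ^ 2) * g (6 * (j + 1 : ℕ) + 1) := by
      rw [e, e]; exact h10
    exact ⟨k2, k4, last (j + 1) k2 k4⟩

theorem IsSchurSeq.factor (hd : IsSchurSeq x q d) (hg : IsSchurSeq (x * q ^ 2) q g)
    (N : ℤ) (hN : 1 ≤ N) :
    d (2 * N) = (1 + x * q + x ^ 2 * q ^ 2) * g (2 * N - 3) := by
  obtain ⟨h2, h4, h6⟩ := hd.factor_period hg ((N - 1) / 3).toNat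
  have : N % 3 = 0 ∨ N % 3 = 1 ∨ N % 3 = 2 := by omega
  rcases this with h | h | h
  · convert h6 using 3 <;> omega
  · convert h2 using 3 <;> omega
  · convert h4 using 3 <;> omega

end Recurrence

theorem alladiSchur_two_mul (N : ℤ) (hN : 1 ≤ N) :
    alladiSchur (2 * N) =
      (1 + X * C X + X ^ 2 * C (X ^ 2)) *
        (alladiSchur (2 * N - 3)).comp (X * C (X ^ 2)) := by
  have hg := isSchurSeq_alladiSchur.map (compRingHom (X * C (X ^ 2) : ℤ[X][X]))
  simp only [coe_compRingHom_apply, X_comp, C_comp] at hg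
  rw [C_pow] at hg ⊢
  exact isSchurSeq_alladiSchur.factor hg N hN

/-! ### Coefficients, counts and the bijection -/

theorem schurCount_of_neg {N m n : ℤ} (h : m < 0 ∨ n < 0) : schurCount N m n = 0 := by
  have : schurSet N m n = ∅ := by
    refine Set.eq_empty_of_forall_notMem fun π hπ => ?_
    have h1 := hπ.2.1
    have h2 := hπ.2.2.1
    omega
  rw [schurCount, this, Set.ncard_empty]

theorem coeff_comp_X_mul_C (p : ℤ[X][X]) (r : ℤ[X]) (m : ℕ) :
    (p.comp (X * C r)).coeff m = p.coeff m * r ^ m := by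
  rw [mul_comm X, comp_C_mul_X_coeff]

/-- The cases `a = 0, 1, 2` are the three terms of the factor `1 + xq + x²q²`. Substituting `xq²`
for `x` multiplies the coefficient of `x^k` by `q^(2k)`, here with `k = m - a`. -/
theorem coeff_shift_alladiSchur (N : ℤ) (a m n : ℕ) :
    ((X ^ a * C (X ^ a) * (alladiSchur N).comp (X * C (X ^ 2))).coeff m).coeff n =
      (schurCount N (m - a) (n - a - 2 * (m - a)) : ℤ) := by
  rw [mul_assoc, coeff_X_pow_mul']
  split_ifs with h
  · rw [coeff_C_mul, coeff_comp_X_mul_C, mul_left_comm, ← pow_mul, ← pow_add, coeff_mul_X_pow']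
    split_ifs with h'
    · rw [alladiSchur_coeff]
      congr 2 <;> omega
    · rw [schurCount_of_neg (by omega), Nat.cast_zero]
  · rw [schurCount_of_neg (by omega), coeff_zero, Nat.cast_zero]

theorem schurCount_two_mul (N : ℤ) (hN : 1 ≤ N) (m n : ℤ) :
    schurCount (2 * N) m n =
      schurCount (2 * N - 3) m (n - 2 * m) +
        schurCount (2 * N - 3) (m - 1) (n - 2 * m + 1) +
        schurCount (2 * N - 3) (m - 2) (n - 2 * m + 2) := by
  by_cases hneg : m < 0 ∨ n < 0
  · rw [schurCount_of_neg hneg, schurCount_of_neg (m := m) (by omega),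
      schurCount_of_neg (m := m - 1) (by omega), schurCount_of_neg (m := m - 2) (by omega)]
  lift m to ℕ using by omega
  lift n to ℕ using by omega
  have h := congrArg (fun p : ℤ[X][X] => (p.coeff m).coeff n) (alladiSchur_two_mul N hN)
  have h0 := coeff_shift_alladiSchur (2 * N - 3) 0 m n
  have h1 := coeff_shift_alladiSchur (2 * N - 3) 1 m n
  have h2 := coeff_shift_alladiSchur (2 * N - 3) 2 m n
  simp only [pow_zero, pow_one, C_1, one_mul] at h0 h1
  simp only [add_mul, one_mul, coeff_add, alladiSchur_coeff, h0, h1, h2] at h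
  zify
  rw [h]
  congr 4 <;> push_cast <;> ring

/-- The three target sets have different weights, so the cardinality of their union is the sum. -/
theorem ncard_union_schurSet (N m k₀ k₁ k₂ : ℤ) :
    (schurSet N m k₀ ∪ schurSet N (m - 1) k₁ ∪ schurSet N (m - 2) k₂).ncard =
      schurCount N m k₀ + schurCount N (m - 1) k₁ + schurCount N (m - 2) k₂ := by
  have disj {m₁ m₂ l₁ l₂ : ℤ} (h : m₁ ≠ m₂) :
      Disjoint (schurSet N m₁ l₁) (schurSet N m₂ l₂) :=
    Set.disjoint_left.2 fun π h1 h2 => h (h1.2.2.1.symm.trans h2.2.2.1)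
  rw [Set.ncard_union_eq (Set.disjoint_union_left.2 ⟨disj (by omega), disj (by omega)⟩)
      ((finite_schurSet _ _ _).union (finite_schurSet _ _ _)) (finite_schurSet _ _ _),
    Set.ncard_union_eq (disj (by omega)) (finite_schurSet _ _ _) (finite_schurSet _ _ _)]
  rfl

theorem exists_bijOn_schurSet (N : ℤ) (hN : 1 ≤ N) :
    ∃ φ : IntPartition → IntPartition, ∀ m n : ℤ,
      Set.BijOn φ (schurSet (2 * N) m n)
        (schurSet (2 * N - 3) m (n - 2 * m) ∪
          schurSet (2 * N - 3) (m - 1) (n - 2 * m + 1) ∪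
          schurSet (2 * N - 3) (m - 2) (n - 2 * m + 2)) := by
  have : Nonempty IntPartition := ⟨ofParts 0 (by simp)⟩
  have key (m n : ℤ) := (finite_schurSet (2 * N) m n).exists_bijOn_of_encard_eq
    (t := schurSet (2 * N - 3) m (n - 2 * m) ∪
          schurSet (2 * N - 3) (m - 1) (n - 2 * m + 1) ∪
          schurSet (2 * N - 3) (m - 2) (n - 2 * m + 2)) (by
      rw [← (finite_schurSet _ _ _).cast_ncard_eq, ← (((finite_schurSet _ _ _).union
        (finite_schurSet _ _ _)).union (finite_schurSet _ _ _)).cast_ncard_eq,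
        ncard_union_schurSet, ← schurCount_two_mul N hN]
      rfl)
  choose f hf using key
  -- The bijections glue to one map because `π` determines its own `m` and `n`.
  refine ⟨fun π => f π.weight π.size π, fun m n => (hf m n).congr ?_⟩
  rintro π ⟨-, hn, hm, -⟩
  simp only [hn, hm]

theorem theorem6 (N : ℤ) (hN : 1 ≤ N) :
    (∃ φ : IntPartition → IntPartition, ∀ m n : ℤ,
      Set.BijOn φ (schurSet (2 * N) m n)
        (schurSet (2 * N - 3) m (n - 2 * m) ∪
          schurSet (2 * N - 3) (m - 1) (n - 2 * m + 1) ∪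
          schurSet (2 * N - 3) (m - 2) (n - 2 * m + 2))) ∧
    (∀ m n : ℤ,
      schurCount (2 * N) m n =
        schurCount (2 * N - 3) m (n - 2 * m) +
          schurCount (2 * N - 3) (m - 1) (n - 2 * m + 1) +
          schurCount (2 * N - 3) (m - 2) (n - 2 * m + 2)) ∧
    alladiSchur (2 * N) =
      (1 + X * C X + X ^ 2 * C (X ^ 2)) *
        (alladiSchur (2 * N - 3)).comp (X * C (X ^ 2)) := by
  exact ⟨exists_bijOn_schurSet N hN, schurCount_two_mul N hN, alladiSchur_two_mul N hN⟩
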